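/- Let $(M,g)$ be a Lorentzian manifold: a smooth (Hausdorff) $4$-manifold $M$ with a smooth metric $g$ of signature $(-,+,+,+)$, and let $D=\nabla$ be its Levi-Civita connection. Let $\Omega\subset M$ be open and let a pressureless perfect fluid on $\Omega$ be given: a congruence of timelike curves, i.e. a family of pairwise disjoint curves $c_j:J_j\to\Omega$ ($J_j\subset\mathbb R$ open intervals) whose images fill $\Omega$, parametrized by proper time, whose unit tangent vectors form a $C^1$ vector field $u$ on $\Omega$ (so $c_j'(t)=u(c_j(t))$ and $g(u,u)=-1$), together with a $C^1$ mass density $\rho:\Omega\to[0,\infty)$ satisfying $\operatorname{div}(\rho u)=\nabla_k(\rho u^k)=0$ on $\Omega$. Let $\tau=\rho\,u\otimes u$ be its energy-momentum tensor, and consider the vector field on $\Omega$ with components $\nabla_k\tau^{kl}$. (1) The fluid curves $c_j$ are all geodesics of $(M,g)$ (that is, $D_{c_j'}c_j'=0$) if and only if $D_uu=0$ on $\Omega$. (2) If the fluid curves are geodesics, then $\nabla_k\tau^{kl}=0$ on $\Omega$. (3) If $\{\rho>0\}$ is dense in $\Omega$ (in particular if $\rho>0$ on $\Omega$), then $\nabla_k\tau^{kl}=0$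 on $\Omega$ if and only if the fluid curves are geodesics of $(M,g)$. -/

import Mathlib

open Bundle FiberBundle VectorField
open scoped Manifold ContDiff TensorProduct

namespace Spacetime

section LeviCivita

variable {E : Type*} [NormedAddCommGroup E] [NormedSpace ℝ E]
  {H : Type*} [TopologicalSpace H] (I : ModelWithCorners ℝ E H)
  (M : Type*) [TopologicalSpace M] [ChartedSpace H M] [IsManifold I ∞ M]

/-- A smooth pseudo-Riemannian metric: a smooth field of nondegenerate symmetric bilinear forms on
the tangent spaces. -/
structure PseudoMetric where
  form (x : M) : TangentSpace I x →L[ℝ] TangentSpace I x →L[ℝ] ℝ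
  symm (x : M) (v w : TangentSpace I x) : form x v w = form x w v
  nondegenerate (x : M) (v : TangentSpace I x) (hv : ∀ w, form x v w = 0) : v = 0
  contMDiff : ContMDiff I (I.prod 𝓘(ℝ, E →L[ℝ] E →L[ℝ] ℝ)) ∞
    (fun x ↦ TotalSpace.mk' (E →L[ℝ] E →L[ℝ] ℝ) x (form x))

variable {I M}

namespace PseudoMetric

variable (g : PseudoMetric I M)

theorem mdifferentiableAt {x : M} {Y Z : Π x : M, TangentSpace I x}
    (hY : MDiffAt (T% Y) x) (hZ : MDiffAt (T% Z) x) :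
    MDiffAt (fun y ↦ g.form y (Y y) (Z y)) x := by
  have : MDifferentiableAt I (I.prod 𝓘(ℝ))
      (fun m ↦ TotalSpace.mk' ℝ (E := Bundle.Trivial M ℝ) m (g.form m (Y m) (Z m))) x := by
    apply MDifferentiableAt.clm_bundle_apply₂ (F₁ := E) (F₂ := E)
    · exact g.contMDiff.mdifferentiableAt (by simp)
    · exact hY
    · exact hZ
  simp only [mdifferentiableAt_totalSpace] at this
  exact this.2

theorem eq_of_form_eq {x : M} {v w : TangentSpace I x}
    (h : ∀ Z : Π x : M, TangentSpace I x, MDiffAt (T% Z) x → g.form x v (Z x) = g.form x w (Z x)) :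
    v = w := by
  rw [← sub_eq_zero]
  apply g.nondegenerate x
  intro z
  have := h (extend E z) (mdifferentiableAt_extend ..)
  rw [extend_apply_self] at this
  simp [this]

variable [FiniteDimensional ℝ E]

/-- The isomorphism `v ↦ g(v, ·)` from tangent vectors to covectors. -/
noncomputable def flat (x : M) : TangentSpace I x ≃ₗ[ℝ] (TangentSpace I x →L[ℝ] ℝ) :=
  haveI : FiniteDimensional ℝ (TangentSpace I x) := inferInstanceAs (FiniteDimensional ℝ E)
  (LinearEquiv.ofInjectiveOfFinrankEq (g.form x).toLinearMap (by
      rw [injective_iff_map_eq_zero]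
      intro v hv
      exact g.nondegenerate x v fun w ↦ by
        simpa using congrArg (fun f : TangentSpace I x →L[ℝ] ℝ ↦ f w) hv)
    ((Subspace.dual_finrank_eq (K := ℝ) (V := E)).symm.trans
      (LinearEquiv.finrank_eq (LinearMap.toContinuousLinearMap (𝕜 := ℝ) (E := E) (F' := ℝ)))))

/-- The right-hand side of the Koszul formula, i.e. the value that `g(∇_X Y, Z)` has to take for
the Levi-Civita connection. -/
noncomputable def koszul (X Y Z : Π x : M, TangentSpace I x) (x : M) : ℝ :=
  (1 / 2 : ℝ) *
    (d% (fun y ↦ g.form y (Y y) (Z y)) x (X x) + d% (fun y ↦ g.form y (Z y) (X y)) x (Y x)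
      - d% (fun y ↦ g.form y (X y) (Y y)) x (Z x)
      + g.form x (mlieBracket I X Y x) (Z x) - g.form x (mlieBracket I X Z x) (Y x)
      - g.form x (mlieBracket I Y Z x) (X x))

theorem koszul_tensorial_left {x : M} {Y Z : Π x : M, TangentSpace I x}
    (hY : MDiffAt (T% Y) x) (hZ : MDiffAt (T% Z) x) :
    TensorialAt I E (fun X ↦ g.koszul X Y Z x) x where
  smul {f X} hf hX := by
    have e1 : (fun y ↦ g.form y (Z y) ((f • X) y)) = fun y ↦ f y * g.form y (Z y) (X y) := by
      ext y; simp
    have e2 : (fun y ↦ g.form y ((f • X) y) (Y y)) = fun y ↦ f y * g.form y (X y) (Y y) := by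
      ext y; simp
    simp only [koszul, e1, e2, mvfderiv_fun_mul hf (g.mdifferentiableAt hZ hX),
      mvfderiv_fun_mul hf (g.mdifferentiableAt hX hY), mlieBracket_smul_left hf hX]
    simp [g.symm x (X x)]
    ring
  add {X X'} hX hX' := by
    have e1 : (fun y ↦ g.form y (Z y) ((X + X') y)) =
        fun y ↦ g.form y (Z y) (X y) + g.form y (Z y) (X' y) := by
      ext y; simp
    have e2 : (fun y ↦ g.form y ((X + X') y) (Y y)) =
        fun y ↦ g.form y (X y) (Y y) + g.form y (X' y) (Y y) := by
      ext y; simp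
    simp only [koszul, e1, e2,
      mvfderiv_fun_add (g.mdifferentiableAt hZ hX) (g.mdifferentiableAt hZ hX'),
      mvfderiv_fun_add (g.mdifferentiableAt hX hY) (g.mdifferentiableAt hX' hY),
      mlieBracket_add_left hX hX']
    simp
    ring

theorem koszul_tensorial_right {x : M} {X Y : Π x : M, TangentSpace I x}
    (hX : MDiffAt (T% X) x) (hY : MDiffAt (T% Y) x) :
    TensorialAt I E (fun Z ↦ g.koszul X Y Z x) x where
  smul {f Z} hf hZ := by
    have e1 : (fun y ↦ g.form y (Y y) ((f • Z) y)) = fun y ↦ f y * g.form y (Y y) (Z y) := by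
      ext y; simp
    have e2 : (fun y ↦ g.form y ((f • Z) y) (X y)) = fun y ↦ f y * g.form y (Z y) (X y) := by
      ext y; simp
    simp only [koszul, e1, e2, mvfderiv_fun_mul hf (g.mdifferentiableAt hY hZ),
      mvfderiv_fun_mul hf (g.mdifferentiableAt hZ hX), mlieBracket_smul_right hf hZ]
    simp [g.symm x (Y x) (Z x)]
    ring
  add {Z Z'} hZ hZ' := by
    have e1 : (fun y ↦ g.form y (Y y) ((Z + Z') y)) =
        fun y ↦ g.form y (Y y) (Z y) + g.form y (Y y) (Z' y) := by
      ext y; simp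
    have e2 : (fun y ↦ g.form y ((Z + Z') y) (X y)) =
        fun y ↦ g.form y (Z y) (X y) + g.form y (Z' y) (X y) := by
      ext y; simp
    simp only [koszul, e1, e2,
      mvfderiv_fun_add (g.mdifferentiableAt hY hZ) (g.mdifferentiableAt hY hZ'),
      mvfderiv_fun_add (g.mdifferentiableAt hZ hX) (g.mdifferentiableAt hZ' hX),
      mlieBracket_add_right hZ hZ']
    simp
    ring

theorem koszul_add {x : M} {X Y Y' Z : Π x : M, TangentSpace I x} (hX : MDiffAt (T% X) x)
    (hY : MDiffAt (T% Y) x) (hY' : MDiffAt (T% Y') x) (hZ : MDiffAt (T% Z) x) :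
    g.koszul X (Y + Y') Z x = g.koszul X Y Z x + g.koszul X Y' Z x := by
  have e1 : (fun y ↦ g.form y ((Y + Y') y) (Z y)) =
      fun y ↦ g.form y (Y y) (Z y) + g.form y (Y' y) (Z y) := by
    ext y; simp
  have e2 : (fun y ↦ g.form y (X y) ((Y + Y') y)) =
      fun y ↦ g.form y (X y) (Y y) + g.form y (X y) (Y' y) := by
    ext y; simp
  simp only [koszul, e1, e2,
    mvfderiv_fun_add (g.mdifferentiableAt hY hZ) (g.mdifferentiableAt hY' hZ),
    mvfderiv_fun_add (g.mdifferentiableAt hX hY) (g.mdifferentiableAt hX hY'),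
    mlieBracket_add_right hY hY', mlieBracket_add_left hY hY']
  simp
  ring

theorem koszul_leibniz {x : M} {X Y Z : Π x : M, TangentSpace I x} {f : M → ℝ} (hX : MDiffAt (T% X) x)
    (hY : MDiffAt (T% Y) x) (hZ : MDiffAt (T% Z) x) (hf : MDiffAt f x) :
    g.koszul X (f • Y) Z x
      = f x * g.koszul X Y Z x + d% f x (X x) * g.form x (Y x) (Z x) := by
  have e1 : (fun y ↦ g.form y ((f • Y) y) (Z y)) = fun y ↦ f y * g.form y (Y y) (Z y) := by
    ext y; simp
  have e2 : (fun y ↦ g.form y (X y) ((f • Y) y)) = fun y ↦ f y * g.form y (X y) (Y y) := by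
    ext y; simp
  simp only [koszul, e1, e2, mvfderiv_fun_mul hf (g.mdifferentiableAt hY hZ),
    mvfderiv_fun_mul hf (g.mdifferentiableAt hX hY), mlieBracket_smul_right hf hY,
    mlieBracket_smul_left hf hY]
  simp [g.symm x (X x) (Y x)]
  ring

open scoped Classical in
/-- The operator underlying the Levi-Civita connection: `g(∇_v Y, w)` is given by the Koszul
formula. (The value at points where `Y` is not differentiable is irrelevant and set to `0`.) -/
noncomputable def leviCivitaAux (Y : Π x : M, TangentSpace I x) (x : M) : TangentSpace I x →L[ℝ] TangentSpace I x :=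
  haveI : FiniteDimensional ℝ (TangentSpace I x) := inferInstanceAs (FiniteDimensional ℝ E)
  haveI : T2Space (TangentSpace I x) := inferInstanceAs (T2Space E)
  if hY : MDiffAt (T% Y) x then
    (LinearMap.toContinuousLinearMap
      ((g.flat x).symm.toLinearMap ∘ₗ
        (TensorialAt.mkHom₂ (fun X Z ↦ g.koszul X Y Z x) x
          (fun _ hZ ↦ g.koszul_tensorial_left hY hZ)
          (fun _ hX ↦ g.koszul_tensorial_right hX hY)).toLinearMap))
  else 0

theorem form_leviCivitaAux {x : M} {X Y Z : Π x : M, TangentSpace I x} (hX : MDiffAt (T% X) x)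
    (hY : MDiffAt (T% Y) x) (hZ : MDiffAt (T% Z) x) :
    g.form x (g.leviCivitaAux Y x (X x)) (Z x) = g.koszul X Y Z x := by
  have h1 : g.flat x (g.leviCivitaAux Y x (X x)) =
      TensorialAt.mkHom₂ (fun X Z ↦ g.koszul X Y Z x) x
          (fun _ hZ ↦ g.koszul_tensorial_left hY hZ)
          (fun _ hX ↦ g.koszul_tensorial_right hX hY) (X x) := by
    rw [leviCivitaAux, dif_pos hY]
    exact (g.flat x).apply_symm_apply _
  have h2 : g.form x (g.leviCivitaAux Y x (X x)) (Z x) =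
    g.flat x (g.leviCivitaAux Y x (X x)) (Z x) := rfl
  rw [h2, h1, TensorialAt.mkHom₂_apply _ _ hX hZ]

/-- The Levi-Civita connection of a pseudo-Riemannian metric. -/
noncomputable def leviCivita : CovariantDerivative I E (TangentSpace I : M → Type _) where
  toFun := g.leviCivitaAux
  isCovariantDerivativeOnUniv :=
    { add := by
        intro Y Y' x hY hY' _
        have hYY : MDiffAt (T% (Y + Y')) x := mdifferentiableAt_add_section hY hY'
        ext1 v
        apply g.eq_of_form_eq
        intro Z hZ
        obtain ⟨X, hX, rfl⟩ : ∃ X : Π x : M, TangentSpace I x, MDiffAt (T% X) x ∧ X x = v :=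
          ⟨extend E v, mdifferentiableAt_extend .., extend_apply_self ..⟩
        rw [g.form_leviCivitaAux hX hYY hZ, g.koszul_add hX hY hY' hZ]
        simp [g.form_leviCivitaAux hX hY hZ, g.form_leviCivitaAux hX hY' hZ]
      leibniz := by
        intro Y f x hY hf _
        have hfY : MDiffAt (T% (f • Y)) x := hf.smul_section hY
        ext1 v
        apply g.eq_of_form_eq
        intro Z hZ
        obtain ⟨X, hX, rfl⟩ : ∃ X : Π x : M, TangentSpace I x, MDiffAt (T% X) x ∧ X x = v :=
          ⟨extend E v, mdifferentiableAt_extend .., extend_apply_self ..⟩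
        rw [g.form_leviCivitaAux hX hfY hZ, g.koszul_leibniz hX hY hZ hf]
        simp [g.form_leviCivitaAux hX hY hZ] }

theorem form_leviCivita {x : M} {X Y Z : Π x : M, TangentSpace I x} (hX : MDiffAt (T% X) x)
    (hY : MDiffAt (T% Y) x) (hZ : MDiffAt (T% Z) x) :
    g.form x (g.leviCivita Y x (X x)) (Z x) = g.koszul X Y Z x :=
  g.form_leviCivitaAux hX hY hZ

/-- The Levi-Civita connection has no torsion. -/
theorem leviCivita_torsion : g.leviCivita.torsion = 0 := by
  rw [CovariantDerivative.torsion_eq_zero_iff]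
  intro X Y x hX hY
  apply g.eq_of_form_eq
  intro Z hZ
  have s : ∀ (A B : Π x : M, TangentSpace I x), (fun y ↦ g.form y (A y) (B y)) =
    fun y ↦ g.form y (B y) (A y) := fun A B ↦ funext fun y ↦ g.symm y _ _
  simp only [map_sub, sub_apply, g.form_leviCivita hX hY hZ, g.form_leviCivita hY hX hZ, koszul]
  rw [s Y X, s Z X, s Z Y, mlieBracket_swap_apply (V := Y) (W := X)]
  simp
  ring

/-- The metric is parallel for the Levi-Civita connection. -/
theorem leviCivita_metric {x : M} {X Y Z : Π x : M, TangentSpace I x} (hX : MDiffAt (T% X) x)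
    (hY : MDiffAt (T% Y) x) (hZ : MDiffAt (T% Z) x) :
    d% (fun y ↦ g.form y (Y y) (Z y)) x (X x) =
      g.form x (g.leviCivita Y x (X x)) (Z x) + g.form x (Y x) (g.leviCivita Z x (X x)) := by
  have s : ∀ (A B : Π x : M, TangentSpace I x), (fun y ↦ g.form y (A y) (B y)) =
    fun y ↦ g.form y (B y) (A y) := fun A B ↦ funext fun y ↦ g.symm y _ _
  rw [g.symm x (Y x), g.form_leviCivita hX hY hZ, g.form_leviCivita hX hZ hY]
  simp only [koszul]
  rw [s Z Y, s X Y, s X Z, mlieBracket_swap_apply (V := Z) (W := Y)]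
  simp
  ring

end PseudoMetric
end LeviCivita

section Dust

variable {M : Type*} [TopologicalSpace M] [ChartedSpace (EuclideanSpace ℝ (Fin 4)) M]
  [IsManifold (𝓡 4) ∞ M]

/-- A Lorentzian metric on a four-dimensional manifold: a metric of signature `(-,+,+,+)`. -/
structure LorentzMetric (M : Type*) [TopologicalSpace M]
    [ChartedSpace (EuclideanSpace ℝ (Fin 4)) M] [IsManifold (𝓡 4) ∞ M]
    extends PseudoMetric (𝓡 4) M where
  signature (x : M) : ∃ b : Module.Basis (Fin 4) ℝ (TangentSpace (𝓡 4) x), ∀ i j : Fin 4,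
    form x (b i) (b j) = if i = j then (if i = 0 then -1 else 1) else 0

/-- Connections on the tangent bundle. -/
abbrev Connection (M : Type*) [TopologicalSpace M] [ChartedSpace (EuclideanSpace ℝ (Fin 4)) M]
    [IsManifold (𝓡 4) ∞ M] :=
  CovariantDerivative (𝓡 4) (EuclideanSpace ℝ (Fin 4)) (TangentSpace (𝓡 4) : M → Type _)

/-- The coordinate vector field `∂ᵢ` of the preferred chart `(x⁰, x¹, x², x³)` at `p`. -/
noncomputable def coordField (p : M) (i : Fin 4) (y : M) : TangentSpace (𝓡 4) y :=
  (trivializationAt (EuclideanSpace ℝ (Fin 4)) (TangentSpace (𝓡 4)) p).symmL ℝ y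
    (EuclideanSpace.single i 1)

/-- The coordinate one-form `dxᵏ` of the preferred chart at `p`. -/
noncomputable def coordForm (p : M) (k : Fin 4) (y : M) : TangentSpace (𝓡 4) y →L[ℝ] ℝ :=
  (EuclideanSpace.proj k : EuclideanSpace ℝ (Fin 4) →L[ℝ] ℝ) ∘L
    (trivializationAt (EuclideanSpace ℝ (Fin 4)) (TangentSpace (𝓡 4)) p).continuousLinearMapAt ℝ y

/-- The Christoffel symbols `Γᵏᵢⱼ` in the preferred chart at `p`, defined by
`D_{∂ᵢ} ∂ⱼ = Γᵏᵢⱼ ∂ₖ`. -/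
noncomputable def christoffel (D : Connection M) (p : M) (k i j : Fin 4) (y : M) : ℝ :=
  coordForm p k y (D (coordField p j) y (coordField p i y))

/-- The component `τᵏˡ = τ(dxᵏ, dxˡ)` of a twice contravariant tensor field in the preferred chart
at `p`. -/
noncomputable def component (τ : Π y : M, TangentSpace (𝓡 4) y ⊗[ℝ] TangentSpace (𝓡 4) y)
    (p : M) (k l : Fin 4) (y : M) : ℝ :=
  LinearMap.mul' ℝ ℝ
    (TensorProduct.map (coordForm p k y).toLinearMap (coordForm p l y).toLinearMap (τ y))

/-- The component `∇ᵢ τᵏˡ = ∂ᵢ τᵏˡ + Γᵏᵢₘ τᵐˡ + Γˡᵢₘ τᵏᵐ` of the covariant derivative of a twice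
contravariant tensor field in the preferred chart at `p`. -/
noncomputable def covDerivComponent (D : Connection M)
    (τ : Π y : M, TangentSpace (𝓡 4) y ⊗[ℝ] TangentSpace (𝓡 4) y)
    (p : M) (i k l : Fin 4) (y : M) : ℝ :=
  mvfderiv (𝓡 4) (component τ p k l) y (coordField p i y)
    + ∑ m, (christoffel D p k i m y * component τ p m l y
      + christoffel D p l i m y * component τ p k m y)

/-- The divergence of a twice contravariant tensor field: the vector field with components
`∇ₖ τᵏˡ`, computed at `x` in the preferred chart at `x`. -/
noncomputable def tensorDivergence (D : Connection M)
    (τ : Π y : M, TangentSpace (𝓡 4) y ⊗[ℝ] TangentSpace (𝓡 4) y) (x : M) :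
    TangentSpace (𝓡 4) x :=
  ∑ l, (∑ k, covDerivComponent D τ x k k l x) • coordField x l x

/-- The divergence `∇ₖ Xᵏ` of a vector field: the trace of `v ↦ D_v X`. -/
noncomputable def divergence (D : Connection M) (X : Π y : M, TangentSpace (𝓡 4) y) (x : M) : ℝ :=
  LinearMap.trace ℝ (TangentSpace (𝓡 4) x) (D X x).toLinearMap

/-- A curve `c`, defined on the open set `J` of parameters, is a geodesic if it is differentiable
and `D_{c'} c' = 0`, i.e. `(xᵏ)'' = - Γᵏᵢⱼ (xⁱ)' (xʲ)'` where `xᵏ` are the coordinates of `c`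
(at each parameter `t` the chart used is the preferred chart at `c t`). -/
structure IsGeodesicOn (D : Connection M) (c : ℝ → M) (J : Set ℝ) : Prop where
  mdifferentiableOn : MDifferentiableOn 𝓘(ℝ, ℝ) (𝓡 4) c J
  equation : ∀ t ∈ J, ∀ k : Fin 4,
    HasDerivAt (deriv fun s ↦ extChartAt (𝓡 4) (c t) (c s) k)
      (-∑ i, ∑ j, christoffel D (c t) k i j (c t)
        * deriv (fun s ↦ extChartAt (𝓡 4) (c t) (c s) i) t
        * deriv (fun s ↦ extChartAt (𝓡 4) (c t) (c s) j) t) t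

/-- A fluid on an open set `Ω`: a congruence of timelike curves, i.e. a family, indexed by `ι`, of
pairwise disjoint curves filling `Ω`, parametrized by proper time on open intervals, together with
a mass density `ρ ≥ 0`. The vector field `u` is the field of unit tangent vectors of the curves. -/
structure Fluid (g : LorentzMetric M) (ι : Type*) where
  Ω : Set M
  isOpen_Ω : IsOpen Ω
  interval : ι → Set ℝ
  isOpen_interval (j : ι) : IsOpen (interval j)
  isConnected_interval (j : ι) : IsConnected (interval j)
  curve : ι → ℝ → M
  mapsTo_curve (j : ι) : Set.MapsTo (curve j) (interval j) Ω
  exists_curve (x : M) (hx : x ∈ Ω) : ∃ j, x ∈ curve j '' interval j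
  disjoint_curve (i j : ι) (hij : i ≠ j) : Disjoint (curve i '' interval i) (curve j '' interval j)
  u : Π x : M, TangentSpace (𝓡 4) x
  tangent (j : ι) : IsMIntegralCurveOn (I := 𝓡 4) (curve j) u (interval j)
  unit (x : M) (hx : x ∈ Ω) : g.form x (u x) (u x) = -1
  contMDiffOn_u : ContMDiffOn (𝓡 4) (𝓡 4).tangent 1
    (fun x ↦ (⟨x, u x⟩ : TangentBundle (𝓡 4) M)) Ω
  ρ : M → ℝ
  contMDiffOn_ρ : ContMDiffOn (𝓡 4) 𝓘(ℝ, ℝ) 1 ρ Ω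
  ρ_nonneg (x : M) (hx : x ∈ Ω) : 0 ≤ ρ x

/-- The energy-momentum tensor `τ = ρ u ⊗ u` of a pressureless perfect fluid. -/
noncomputable def Fluid.energyMomentum {g : LorentzMetric M} {ι : Type*} (F : Fluid g ι) (x : M) :
    TangentSpace (𝓡 4) x ⊗[ℝ] TangentSpace (𝓡 4) x :=
  F.ρ x • (F.u x ⊗ₜ[ℝ] F.u x)

end Dust

end Spacetime

/-! The product rule gives `∇ₖ(ρ uᵏ uˡ) = div(ρu) uˡ + ρ (D_u u)ˡ` (`tensorDivergence_smul_tmul`),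
so under mass conservation the divergence of the dust tensor is `ρ D_u u`. The geodesic condition is
also pointwise in `u`: along a fluid curve the coordinate velocities are `uᵏ ∘ c`, so the second
derivatives are `u(uᵏ)`, and the geodesic equation at `t` says exactly that `D_u u` vanishes at `c
t` (`geodesicEquation_iff`). Since the curves fill `Ω`, this gives (1), and (2) follows.

For (3), `ρ D_u u = 0` yields `D_u u = 0` only where `ρ > 0`, and density must carry this to the
rest of `Ω`. The connection is defined point by point from the Koszul formula, so continuity of `D_u
u` is not immediate. For `g(u, u)` constant, however, the formula reduces to `g(D_u u, Z) = u(g(u,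
Z)) - g([u, Z], u)`, which is continuous for `C^1` fields `u` and `Z`. Nondegeneracy then finishes
the proof (`PseudoMetric.leviCivita_self_eq_zero_of_mem_closure`). -/

namespace Spacetime

open Filter Topology

/-! ### Coordinate frames and the covariant derivative in components. -/

section Coordinates

variable {M : Type*} [TopologicalSpace M] [ChartedSpace (EuclideanSpace ℝ (Fin 4)) M]
  [IsManifold (𝓡 4) ∞ M]

/-- Differentiability of a vector field at a point. -/
abbrev FieldDiffAt (X : Π x : M, TangentSpace (𝓡 4) x) (x : M) : Prop :=
  MDifferentiableAt (𝓡 4) ((𝓡 4).prod 𝓘(ℝ, EuclideanSpace ℝ (Fin 4))) (T% X) x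

/-- The domain of the preferred chart at `p`, as the base set of the trivialization there. -/
abbrev coordDomain (p : M) : Set M :=
  (trivializationAt (EuclideanSpace ℝ (Fin 4)) (TangentSpace (𝓡 4)) p).baseSet

theorem isOpen_coordDomain (p : M) : IsOpen (coordDomain p) :=
  (trivializationAt (EuclideanSpace ℝ (Fin 4)) (TangentSpace (𝓡 4)) p).open_baseSet

theorem mem_coordDomain (p : M) : p ∈ coordDomain p :=
  FiberBundle.mem_baseSet_trivializationAt' p

theorem coordDomain_mem_nhds (p : M) : coordDomain p ∈ 𝓝 p :=
  (isOpen_coordDomain p).mem_nhds (mem_coordDomain p)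

theorem coordForm_coordField {p y : M} (hy : y ∈ coordDomain p) (k i : Fin 4) :
    coordForm p k y (coordField p i y) = if k = i then 1 else 0 := by
  have := (trivializationAt (EuclideanSpace ℝ (Fin 4)) (TangentSpace (𝓡 4)) p).continuousLinearMapAt_symmL
    (R := ℝ) hy (EuclideanSpace.single i 1)
  simp only [coordForm, coordField, ContinuousLinearMap.comp_apply, this]
  simp [PiLp.single_apply]

theorem sum_coordForm_smul_coordField {p y : M} (hy : y ∈ coordDomain p)
    (v : TangentSpace (𝓡 4) y) : ∑ k, coordForm p k y v • coordField p k y = v := by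
  set e := trivializationAt (EuclideanSpace ℝ (Fin 4)) (TangentSpace (𝓡 4)) p
  simp only [coordField, ← map_smul, ← map_sum]
  conv_rhs => rw [← e.symmL_continuousLinearMapAt (R := ℝ) hy v]
  congr 1
  ext i
  simp [coordForm, e, Pi.single_apply]

/-- Read in the trivialization at `p`, the field is constant near `y`. -/
theorem mdifferentiableAt_coordField {p y : M} (hy : y ∈ coordDomain p) (i : Fin 4) :
    FieldDiffAt (coordField p i) y := by
  set e := trivializationAt (EuclideanSpace ℝ (Fin 4)) (TangentSpace (𝓡 4)) p
  refine (e.mdifferentiableAt_section_iff _ _ hy).2 ?_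
  refine (mdifferentiableAt_const (c := EuclideanSpace.single i (1 : ℝ))).congr_of_eventuallyEq ?_
  filter_upwards [e.open_baseSet.mem_nhds hy] with z hz
  have := e.continuousLinearMapAt_symmL (R := ℝ) hz (EuclideanSpace.single i 1)
  rwa [Trivialization.continuousLinearMapAt_apply, e.coe_linearMapAt_of_mem hz] at this

theorem mdifferentiableAt_coordForm {p y : M} (hy : y ∈ coordDomain p) (k : Fin 4)
    {X : Π x : M, TangentSpace (𝓡 4) x} (hX : FieldDiffAt X y) :
    MDifferentiableAt (𝓡 4) 𝓘(ℝ, ℝ) (fun z ↦ coordForm p k z (X z)) y := by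
  set e := trivializationAt (EuclideanSpace ℝ (Fin 4)) (TangentSpace (𝓡 4)) p
  have hX := (e.mdifferentiableAt_section_iff _ _ hy).1 hX
  have h2 : MDifferentiableAt 𝓘(ℝ, EuclideanSpace ℝ (Fin 4)) 𝓘(ℝ, ℝ)
      (EuclideanSpace.proj k : EuclideanSpace ℝ (Fin 4) →L[ℝ] ℝ) (e (X y)).2 :=
    (EuclideanSpace.proj k : EuclideanSpace ℝ (Fin 4) →L[ℝ] ℝ).mdifferentiableAt
  refine (h2.comp y hX).congr_of_eventuallyEq ?_
  filter_upwards [e.open_baseSet.mem_nhds hy] with z hz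
  rw [coordForm, ContinuousLinearMap.comp_apply, Trivialization.continuousLinearMapAt_apply,
    e.coe_linearMapAt_of_mem hz]
  rfl

/-- A covariant derivative of a finite sum `∑ fᵢ Xᵢ`. -/
theorem covDeriv_sum_smul (D : Connection M) {ι : Type*} (s : Finset ι) {x : M}
    {f : ι → M → ℝ} {X : ι → Π x : M, TangentSpace (𝓡 4) x}
    (hf : ∀ i, MDifferentiableAt (𝓡 4) 𝓘(ℝ, ℝ) (f i) x) (hX : ∀ i, FieldDiffAt (X i) x) (v : TangentSpace (𝓡 4) x) :
    D (fun y ↦ ∑ i ∈ s, f i y • X i y) x v =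
      ∑ i ∈ s, (f i x • D (X i) x v + mvfderiv (𝓡 4) (f i) x v • X i x) := by
  classical
  induction s using Finset.induction_on with
  | empty =>
    have := D.isCovariantDerivativeOnUniv.zero (x := x)
    simp only [Finset.sum_empty]
    exact congrArg (fun A ↦ A v) this
  | insert i s hi ih =>
    have h1 : (fun y ↦ ∑ j ∈ insert i s, f j y • X j y) =
        (f i • X i) + fun y ↦ ∑ j ∈ s, f j y • X j y := by
      ext1 y; simp [Finset.sum_insert hi]
    have hs : FieldDiffAt (fun y ↦ ∑ j ∈ s, f j y • X j y) x :=
      MDifferentiableAt.sum_section fun j _ ↦ (hf j).smul_section (hX j)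
    rw [h1, D.isCovariantDerivativeOnUniv.add ((hf i).smul_section (hX i)) hs,
      D.isCovariantDerivativeOnUniv.leibniz (hX i) (hf i), Finset.sum_insert hi, ← ih]
    simp

/-- The coordinate formula `(D_v X)ᵏ = v(Xᵏ) + Γᵏᵢⱼ vⁱ Xʲ`. -/
theorem coordForm_covDeriv (D : Connection M) {p y : M} (hy : y ∈ coordDomain p)
    {X : Π x : M, TangentSpace (𝓡 4) x} (hX : FieldDiffAt X y) (v : TangentSpace (𝓡 4) y)
    (k : Fin 4) :
    coordForm p k y (D X y v) = mvfderiv (𝓡 4) (fun z ↦ coordForm p k z (X z)) y v +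
      ∑ i, ∑ j, christoffel D p k i j y * coordForm p i y v * coordForm p j y (X y) := by
  have hX' : FieldDiffAt (fun z ↦ ∑ j, coordForm p j z (X z) • coordField p j z) y :=
    MDifferentiableAt.sum_section fun j _ ↦
      (mdifferentiableAt_coordForm hy j hX).smul_section (mdifferentiableAt_coordField hy j)
  -- The expansion in the frame holds only on the chart domain, so locality of `D` is needed here.
  have h1 : D X y = D (fun z ↦ ∑ j, coordForm p j z (X z) • coordField p j z) y := by
    refine D.isCovariantDerivativeOnUniv.congr_of_eventuallyEq hX hX' univ_mem ?_
    filter_upwards [(isOpen_coordDomain p).mem_nhds hy] with z hz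
    exact (sum_coordForm_smul_coordField hz _).symm
  have h2 (j : Fin 4) : coordForm p k y (D (coordField p j) y v) =
      ∑ i, christoffel D p k i j y * coordForm p i y v := by
    conv_lhs => rw [← sum_coordForm_smul_coordField hy v]
    simp [christoffel, mul_comm]
  rw [h1, covDeriv_sum_smul D _ (fun j ↦ mdifferentiableAt_coordForm hy j hX)
    (fun j ↦ mdifferentiableAt_coordField hy j), map_sum]
  simp only [map_add, map_smul, coordForm_coordField hy, h2, smul_eq_mul, Finset.sum_add_distrib]
  rw [Finset.sum_comm (f := fun i j ↦ christoffel D p k i j y * _ * _)]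
  simp [Finset.mul_sum, add_comm, mul_comm]

theorem eq_zero_iff_coordForm {p y : M} (hy : y ∈ coordDomain p) (v : TangentSpace (𝓡 4) y) :
    v = 0 ↔ ∀ k, coordForm p k y v = 0 := by
  refine ⟨fun h k ↦ by simp [h], fun h ↦ ?_⟩
  rw [← sum_coordForm_smul_coordField hy v]
  simp [h]

/-- The divergence is the trace of the matrix of components of the covariant derivative. -/
theorem divergence_eq_sum (D : Connection M) {p y : M} (hy : y ∈ coordDomain p)
    (X : Π x : M, TangentSpace (𝓡 4) x) :
    divergence D X y = ∑ k, coordForm p k y (D X y (coordField p k y)) := by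
  -- The coordinate frame as a basis with dual basis `dxᵏ`: the trace becomes the sum of diagonal
  -- entries.
  let b : Module.Basis (Fin 4) ℝ (TangentSpace (𝓡 4) y) := Module.Basis.ofEquivFun
    { toFun := fun v k ↦ coordForm p k y v
      invFun := fun a ↦ ∑ k, a k • coordField p k y
      map_add' := fun v w ↦ by ext; simp
      map_smul' := fun c v ↦ by ext; simp
      left_inv := fun v ↦ sum_coordForm_smul_coordField hy v
      right_inv := fun a ↦ by ext k; simp [coordForm_coordField hy] }
  have hb (k) : b k = coordField p k y := by
    simp [b, Module.Basis.ofEquivFun, Pi.single_apply]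
  have hr (v k) : b.repr v k = coordForm p k y v := by
    simp [b, Module.Basis.ofEquivFun]
  rw [divergence, LinearMap.trace_eq_matrix_trace ℝ b, Matrix.trace]
  simp [LinearMap.toMatrix_apply, hb, hr]

/-! ### Divergence of the dust tensor. -/

/-- The divergence of `ρ u ⊗ u` is `div(ρ u) u + ρ D_u u`. -/
theorem tensorDivergence_smul_tmul (D : Connection M) {x : M} {ρ : M → ℝ}
    {u : Π x : M, TangentSpace (𝓡 4) x} (hρ : MDifferentiableAt (𝓡 4) 𝓘(ℝ, ℝ) ρ x) (hu : FieldDiffAt u x) :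
    tensorDivergence D (fun y ↦ ρ y • (u y ⊗ₜ[ℝ] u y)) x =
      divergence D (fun y ↦ ρ y • u y) x • u x + ρ x • D u x (u x) := by
  have hx := mem_coordDomain x
  have hρu : FieldDiffAt (fun y ↦ ρ y • u y) x := hρ.smul_section hu
  -- The density is attached to the first factor, `(ρu)ᵏ uˡ`, so that the product rule produces
  -- `div(ρu)` directly.
  have hc (k l : Fin 4) : component (fun y ↦ ρ y • (u y ⊗ₜ[ℝ] u y)) x k l =
      fun y ↦ coordForm x k y (ρ y • u y) * coordForm x l y (u y) := by
    ext y; simp [component]; ring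
  have key (l : Fin 4) : ∑ k, covDerivComponent D (fun y ↦ ρ y • (u y ⊗ₜ[ℝ] u y)) x k k l x =
      coordForm x l x (divergence D (fun y ↦ ρ y • u y) x • u x + ρ x • D u x (u x)) := by
    have hlin : mvfderiv (𝓡 4) (fun z ↦ coordForm x l z (u z)) x (u x) =
        ∑ k, coordForm x k x (u x) *
          mvfderiv (𝓡 4) (fun z ↦ coordForm x l z (u z)) x (coordField x k x) := by
      conv_lhs => rw [← sum_coordForm_smul_coordField hx (u x)]
      simp
    -- Summed over `k`, the first group is `div(ρu) uˡ`; the second is `ρ (D_u u)ˡ`, by `hlin`.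
    have hcov (k : Fin 4) : covDerivComponent D (fun y ↦ ρ y • (u y ⊗ₜ[ℝ] u y)) x k k l x =
        (mvfderiv (𝓡 4) (fun z ↦ coordForm x k z (ρ z • u z)) x (coordField x k x) +
          ∑ m, christoffel D x k k m x * coordForm x m x (ρ x • u x)) * coordForm x l x (u x) +
        ρ x * (coordForm x k x (u x) *
            mvfderiv (𝓡 4) (fun z ↦ coordForm x l z (u z)) x (coordField x k x) +
          ∑ m, christoffel D x l k m x * coordForm x k x (u x) * coordForm x m x (u x)) := by
      rw [covDerivComponent, hc, mvfderiv_fun_mul (mdifferentiableAt_coordForm hx k hρu)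
        (mdifferentiableAt_coordForm hx l hu)]
      simp only [hc, Finset.sum_add_distrib, add_mul, mul_add, Finset.sum_mul, Finset.mul_sum]
      simp only [add_apply, smul_apply, smul_eq_mul, map_smul]
      simp only [mul_left_comm, mul_comm]
      ring
    simp only [hcov, map_add, map_smul _ _ (u x), map_smul _ _ (D u x (u x)), smul_eq_mul,
      divergence_eq_sum D hx, coordForm_covDeriv D hx hρu, coordForm_covDeriv D hx hu, hlin,
      coordForm_coordField hx, Finset.sum_add_distrib, ← Finset.mul_sum, ← Finset.sum_mul]
    simp
  rw [tensorDivergence, Finset.sum_congr rfl fun l _ ↦ by rw [key l]]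
  exact sum_coordForm_smul_coordField hx _

/-! ### Integral curves and the geodesic equation. -/

/-- Along an integral curve the velocity of the coordinates is given by the components of the
vector field. -/
theorem hasDerivAt_extChartAt_comp {p : M} {c : ℝ → M} {v : Π x : M, TangentSpace (𝓡 4) x} {s : ℝ}
    (hc : IsMIntegralCurveAt c v s) (hs : c s ∈ coordDomain p) (k : Fin 4) :
    HasDerivAt (fun r ↦ extChartAt (𝓡 4) p (c r) k) (coordForm p k (c s) (v (c s))) s := by
  have hs' : c s ∈ (chartAt (EuclideanSpace ℝ (Fin 4)) p).source := by
    simpa [coordDomain] using hs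
  have h1 := (mdifferentiableAt_extChartAt (I := 𝓡 4) hs').hasMFDerivAt
  have h2 := (h1.comp s hc.hasMFDerivAt).hasFDerivAt
  have h3 := ((EuclideanSpace.proj k : EuclideanSpace ℝ (Fin 4) →L[ℝ] ℝ).hasFDerivAt.comp s
    h2).hasDerivAt
  have h4 := TangentBundle.continuousLinearMapAt_trivializationAt (I := 𝓡 4) hs'
  have h5 : (mfderiv (𝓡 4) 𝓘(ℝ, EuclideanSpace ℝ (Fin 4)) (extChartAt (𝓡 4) p) (c s))
      ((1 : ℝ) • v (c s)) = (mfderiv (𝓡 4) 𝓘(ℝ, EuclideanSpace ℝ (Fin 4))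
        (extChartAt (𝓡 4) p) (c s)) (v (c s)) := by rw [one_smul]
  convert! h3 using 1
  rw [coordForm, h4]
  exact (congrArg (EuclideanSpace.proj k : EuclideanSpace ℝ (Fin 4) →L[ℝ] ℝ) h5).symm

omit [IsManifold (𝓡 4) ∞ M] in
/-- The derivative of a function along an integral curve. -/
theorem hasDerivAt_comp_integralCurve {f : M → ℝ} {c : ℝ → M} {v : Π x : M, TangentSpace (𝓡 4) x}
    {s : ℝ} (hc : IsMIntegralCurveAt c v s) (hf : MDifferentiableAt (𝓡 4) 𝓘(ℝ, ℝ) f (c s)) :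
    HasDerivAt (fun r ↦ f (c r)) (mvfderiv (𝓡 4) f (c s) (v (c s))) s := by
  have h : HasDerivAt (fun r ↦ f (c r)) _ s :=
    HasFDerivAt.hasDerivAt (𝕜 := ℝ) (F := ℝ) (hf.hasMFDerivAt.comp s hc.hasMFDerivAt).hasFDerivAt
  have h' : mfderiv (𝓡 4) 𝓘(ℝ, ℝ) f (c s) ((1 : ℝ) • v (c s)) =
      mfderiv (𝓡 4) 𝓘(ℝ, ℝ) f (c s) (v (c s)) := by rw [one_smul]
  convert! h using 1
  exact h'.symm

/-- The geodesic equation in coordinates for an integral curve of a differentiable field. -/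
theorem geodesicEquation_iff (D : Connection M) {c : ℝ → M} {u : Π x : M, TangentSpace (𝓡 4) x}
    {t : ℝ} (hc : IsMIntegralCurveAt c u t) (hu : FieldDiffAt u (c t)) :
    (∀ k : Fin 4, HasDerivAt (deriv fun s ↦ extChartAt (𝓡 4) (c t) (c s) k)
      (-∑ i, ∑ j, christoffel D (c t) k i j (c t)
        * deriv (fun s ↦ extChartAt (𝓡 4) (c t) (c s) i) t
        * deriv (fun s ↦ extChartAt (𝓡 4) (c t) (c s) j) t) t) ↔
      D u (c t) (u (c t)) = 0 := by
  have hx := mem_coordDomain (c t)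
  -- A second derivative at `t` requires the velocity on a whole neighbourhood of `t`, in the fixed
  -- chart at `c t`.
  have hev : ∀ᶠ s in 𝓝 t, IsMIntegralCurveAt c u s ∧ c s ∈ coordDomain (c t) :=
    (eventually_eventually_nhds.2 hc).and
      (hc.hasMFDerivAt.continuousAt.eventually (coordDomain_mem_nhds (c t)))
  rw [eq_zero_iff_coordForm hx]
  refine forall_congr' fun k ↦ ?_
  have hd : (deriv fun s ↦ extChartAt (𝓡 4) (c t) (c s) k) =ᶠ[𝓝 t]
      fun s ↦ coordForm (c t) k (c s) (u (c s)) := by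
    filter_upwards [hev] with s hs
    exact (hasDerivAt_extChartAt_comp hs.1 hs.2 k).deriv
  have h0 (i : Fin 4) := (hasDerivAt_extChartAt_comp hc hx i).deriv
  have hu' := hasDerivAt_comp_integralCurve hc (mdifferentiableAt_coordForm hx k hu)
  rw [hd.hasDerivAt_iff, coordForm_covDeriv D hx hu]
  simp only [h0]
  rw [← eq_neg_iff_add_eq_zero]
  -- The second derivative exists in any case, with value `u(uᵏ)`; the equation only prescribes that
  -- value.
  exact ⟨fun h ↦ hu'.unique h, fun h ↦ h ▸ hu'⟩

end Coordinates

/-! ### Continuity of `D_u u` for fields of constant length. -/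

section UnitField

variable {M : Type*} [TopologicalSpace M] [ChartedSpace (EuclideanSpace ℝ (Fin 4)) M]
  [IsManifold (𝓡 4) ∞ M]

/-- `C^n` regularity of a vector field at a point. -/
abbrev FieldContDiffAt (n : ℕ∞ω) (X : Π x : M, TangentSpace (𝓡 4) x) (x : M) : Prop :=
  ContMDiffAt (𝓡 4) ((𝓡 4).prod 𝓘(ℝ, EuclideanSpace ℝ (Fin 4))) n (T% X) x

theorem PseudoMetric.contMDiffAt_form (g : PseudoMetric (𝓡 4) M) {n : ℕ∞} {x : M}
    {Y Z : Π x : M, TangentSpace (𝓡 4) x}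
    (hY : FieldContDiffAt n Y x) (hZ : FieldContDiffAt n Z x) :
    ContMDiffAt (𝓡 4) 𝓘(ℝ, ℝ) n (fun y ↦ g.form y (Y y) (Z y)) x := by
  have : ContMDiffAt (𝓡 4) ((𝓡 4).prod 𝓘(ℝ)) n
      (fun m ↦ TotalSpace.mk' ℝ (E := Bundle.Trivial M ℝ) m (g.form m (Y m) (Z m))) x := by
    apply ContMDiffAt.clm_bundle_apply₂ (F₁ := EuclideanSpace ℝ (Fin 4))
      (F₂ := EuclideanSpace ℝ (Fin 4))
    · exact (g.contMDiff x).of_le (by exact_mod_cast le_top)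
    · exact hY
    · exact hZ
  simp only [contMDiffAt_totalSpace] at this
  exact this.2

/-- The derivative of a `C^1` function along a continuous vector field is continuous. -/
theorem continuousAt_mvfderiv_apply {f : M → ℝ} {X : Π x : M, TangentSpace (𝓡 4) x} {x : M}
    (hf : ContMDiffAt (𝓡 4) 𝓘(ℝ, ℝ) 1 f x) (hX : FieldContDiffAt 0 X x) :
    ContinuousAt (fun y ↦ mvfderiv (𝓡 4) f y (X y)) x := by
  obtain ⟨s, hs, hfs⟩ := (contMDiffAt_iff_contMDiffOn_nhds (by simp)).1 hf
  obtain ⟨o, hos, ho, hxo⟩ := mem_nhds_iff.1 hs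
  -- The derivative along `X` is the fibre part of the tangent map composed with the section `X`; on
  -- the open set `o` the derivative within `o` is the full one.
  have h1 := (hfs.mono hos).continuousOn_tangentMapWithin le_rfl ho.uniqueMDiffOn
  have h2 : ContinuousAt (fun y ↦ tangentMapWithin (𝓡 4) 𝓘(ℝ, ℝ) f o ⟨y, X y⟩) x :=
    ContinuousAt.comp (f := fun y ↦ (⟨y, X y⟩ : TangentBundle (𝓡 4) M))
      (h1.continuousAt ((ho.preimage (FiberBundle.continuous_proj _ _)).mem_nhds hxo))
      hX.continuousAt
  have h3 : ContinuousAt (fun y ↦ (tangentBundleModelSpaceHomeomorph 𝓘(ℝ, ℝ)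
      (tangentMapWithin (𝓡 4) 𝓘(ℝ, ℝ) f o ⟨y, X y⟩)).2) x :=
    (continuous_snd.comp (tangentBundleModelSpaceHomeomorph 𝓘(ℝ, ℝ)).continuous).continuousAt.comp
      h2
  refine h3.congr ?_
  filter_upwards [ho.mem_nhds hxo] with y hy
  simp only [tangentMapWithin, mvfderiv, mfderivWithin_of_isOpen ho hy]
  rfl

/-- For a unit field `u`, `g(D_u u, Z) = u(g(u, Z)) - g([u, Z], u)`. -/
theorem PseudoMetric.form_leviCivita_unit (g : PseudoMetric (𝓡 4) M) {x : M}
    {u Z : Π x : M, TangentSpace (𝓡 4) x} (hu : FieldDiffAt u x) (hZ : FieldDiffAt Z x)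
    {a : ℝ} (h : ∀ᶠ y in 𝓝 x, g.form y (u y) (u y) = a) :
    g.form x (g.leviCivita u x (u x)) (Z x) =
      mvfderiv (𝓡 4) (fun y ↦ g.form y (u y) (Z y)) x (u x) -
        g.form x (mlieBracket (𝓡 4) u Z x) (u x) := by
  have h0 : mvfderiv (𝓡 4) (fun y ↦ g.form y (u y) (u y)) x = 0 := by
    have h' : (fun y ↦ g.form y (u y) (u y)) =ᶠ[𝓝 x] fun _ ↦ a := h
    rw [mvfderiv, h'.mfderiv_eq, mfderiv_const]
    exact ContinuousLinearMap.comp_zero _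
  have hs : (fun y ↦ g.form y (Z y) (u y)) = fun y ↦ g.form y (u y) (Z y) :=
    funext fun y ↦ g.symm y _ _
  rw [g.form_leviCivita hu hu hZ, PseudoMetric.koszul, h0, hs, mlieBracket_self]
  simp
  ring

/-- If a `C^1` unit field is geodesic at points accumulating at `x`, it is geodesic at `x`. -/
theorem PseudoMetric.leviCivita_self_eq_zero_of_mem_closure (g : PseudoMetric (𝓡 4) M)
    {u : Π x : M, TangentSpace (𝓡 4) x} {x : M} {s : Set M} (hu : FieldContDiffAt 1 u x)
    {a : ℝ} (h : ∀ᶠ y in 𝓝 x, g.form y (u y) (u y) = a) (hx : x ∈ closure s)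
    (hs : ∀ y ∈ s, g.leviCivita u y (u y) = 0) : g.leviCivita u x (u x) = 0 := by
  apply g.nondegenerate x
  intro w
  -- Testing against a field instead of the single vector `w` lets the points of `s` be compared
  -- with `x`.
  set Z : Π x : M, TangentSpace (𝓡 4) x := extend (EuclideanSpace ℝ (Fin 4)) w
  have hZ : FieldContDiffAt 1 Z x := contMDiffAt_extend ..
  -- The bracket costs one derivative, so `C^1` fields have a continuous bracket.
  have hbr : FieldContDiffAt 0 (mlieBracket (𝓡 4) u Z) x :=
    have : IsManifold (𝓡 4) (((1 : ℕ∞) : ℕ∞ω) + 1) M := IsManifold.of_le (n := ∞) (by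
      exact_mod_cast le_top)
    have : IsManifold (𝓡 4) (minSmoothness ℝ 2) M := by
      rw [minSmoothness_of_isRCLikeNormedField]
      exact IsManifold.of_le (n := ∞) (WithTop.coe_le_coe.2 (le_top : (2 : ℕ∞) ≤ ⊤))
    have : IsManifold (𝓡 4) (minSmoothness ℝ 3) M := by
      rw [minSmoothness_of_isRCLikeNormedField]
      exact IsManifold.of_le (n := ∞) (WithTop.coe_le_coe.2 (le_top : (3 : ℕ∞) ≤ ⊤))
    ContMDiffAt.mlieBracket_vectorField (m := 0) (n := 1) hu hZ (by simp)
  have hu0 : FieldContDiffAt 0 u x := hu.of_le zero_le_one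
  have hcont : ContinuousAt (fun y ↦ mvfderiv (𝓡 4) (fun z ↦ g.form z (u z) (Z z)) y (u y) -
      g.form y (mlieBracket (𝓡 4) u Z y) (u y)) x :=
    (continuousAt_mvfderiv_apply (g.contMDiffAt_form (n := 1) hu hZ) hu0).sub
      (g.contMDiffAt_form (n := 0) hbr hu0).continuousAt
  have hev : (fun y ↦ g.form y (g.leviCivita u y (u y)) (Z y)) =ᶠ[𝓝 x] fun y ↦
      mvfderiv (𝓡 4) (fun z ↦ g.form z (u z) (Z z)) y (u y) -
        g.form y (mlieBracket (𝓡 4) u Z y) (u y) := by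
    filter_upwards [(contMDiffAt_iff_contMDiffAt_nhds (by simp)).1 hu,
      (contMDiffAt_iff_contMDiffAt_nhds (by simp)).1 hZ, h.eventually_nhds] with y hy hZy hay
    exact g.form_leviCivita_unit (hy.mdifferentiableAt one_ne_zero)
      (hZy.mdifferentiableAt one_ne_zero) hay
  have hcont' := hcont.congr hev.symm
  have hZx : Z x = w := extend_apply_self ..
  rw [← hZx]
  have := mem_closure_iff_nhdsWithin_neBot.1 hx
  -- Approaching `x` within `s`, `g(D_u u, Z)` tends to its value at `x` by continuity, and it is
  -- identically zero on `s`.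
  refine tendsto_nhds_unique (hcont'.tendsto.mono_left (nhdsWithin_le_nhds (s := s)))
    (tendsto_const_nhds.congr' ?_)
  filter_upwards [self_mem_nhdsWithin] with y hy
  simp [hs y hy]

end UnitField

/-! ### Application to the fluid. -/

namespace Fluid

variable {M : Type*} [TopologicalSpace M] [ChartedSpace (EuclideanSpace ℝ (Fin 4)) M]
  [IsManifold (𝓡 4) ∞ M] {g : LorentzMetric M} {ι : Type*} (F : Fluid g ι)

theorem contMDiffAt_u {x : M} (hx : x ∈ F.Ω) : FieldContDiffAt 1 F.u x :=
  F.contMDiffOn_u.contMDiffAt (F.isOpen_Ω.mem_nhds hx)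

theorem mdifferentiableAt_u {x : M} (hx : x ∈ F.Ω) : FieldDiffAt F.u x :=
  (F.contMDiffAt_u hx).mdifferentiableAt one_ne_zero

theorem mdifferentiableAt_ρ {x : M} (hx : x ∈ F.Ω) : MDifferentiableAt (𝓡 4) 𝓘(ℝ, ℝ) F.ρ x :=
  (F.contMDiffOn_ρ.contMDiffAt (F.isOpen_Ω.mem_nhds hx)).mdifferentiableAt one_ne_zero

/-- The fluid curves are geodesics if and only if `D_u u = 0`. -/
theorem isGeodesicOn_iff (D : Connection M) :
    (∀ j, IsGeodesicOn D (F.curve j) (F.interval j)) ↔ ∀ x ∈ F.Ω, D F.u x (F.u x) = 0 := by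
  have hc {j : ι} {t : ℝ} (ht : t ∈ F.interval j) : IsMIntegralCurveAt (F.curve j) F.u t :=
    (F.tangent j).isMIntegralCurveAt ((F.isOpen_interval j).mem_nhds ht)
  have hiff {j : ι} {t : ℝ} (ht : t ∈ F.interval j) :=
    geodesicEquation_iff D (hc ht) (F.mdifferentiableAt_u (F.mapsTo_curve j ht))
  refine ⟨fun h x hx ↦ ?_, fun h j ↦ ⟨fun t ht ↦ ?_, fun t ht ↦ ?_⟩⟩
  · obtain ⟨j, t, ht, rfl⟩ := F.exists_curve x hx
    exact (hiff ht).1 ((h j).equation t ht)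
  · exact (hc ht).hasMFDerivAt.mdifferentiableAt.mdifferentiableWithinAt
  · exact (hiff ht).2 (h _ (F.mapsTo_curve j ht))

/-- If the mass is conserved, then `∇ₖ τᵏˡ = ρ (D_u u)ˡ`. -/
theorem tensorDivergence_energyMomentum (D : Connection M) {x : M} (hx : x ∈ F.Ω)
    (hdiv : divergence D (fun y ↦ F.ρ y • F.u y) x = 0) :
    tensorDivergence D F.energyMomentum x = F.ρ x • D F.u x (F.u x) := by
  have := tensorDivergence_smul_tmul D (F.mdifferentiableAt_ρ hx) (F.mdifferentiableAt_u hx)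
  rwa [hdiv, zero_smul, zero_add] at this

end Fluid

end Spacetime

theorem mainTheorem7 {M : Type*} [TopologicalSpace M] [T2Space M]
    [ChartedSpace (EuclideanSpace ℝ (Fin 4)) M] [IsManifold (𝓡 4) ∞ M]
    (g : Spacetime.LorentzMetric M) {ι : Type*} (F : Spacetime.Fluid g ι)
    (hdiv : ∀ x ∈ F.Ω, Spacetime.divergence g.leviCivita (fun y ↦ F.ρ y • F.u y) x = 0) :
    ((∀ j, Spacetime.IsGeodesicOn g.leviCivita (F.curve j) (F.interval j)) ↔
        ∀ x ∈ F.Ω, g.leviCivita F.u x (F.u x) = 0) ∧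
    ((∀ j, Spacetime.IsGeodesicOn g.leviCivita (F.curve j) (F.interval j)) →
        ∀ x ∈ F.Ω, Spacetime.tensorDivergence g.leviCivita F.energyMomentum x = 0) ∧
    (F.Ω ⊆ closure {x ∈ F.Ω | 0 < F.ρ x} →
      ((∀ x ∈ F.Ω, Spacetime.tensorDivergence g.leviCivita F.energyMomentum x = 0) ↔
        ∀ j, Spacetime.IsGeodesicOn g.leviCivita (F.curve j) (F.interval j))) := by
  have h1 := F.isGeodesicOn_iff g.leviCivita
  have h2 : (∀ j, Spacetime.IsGeodesicOn g.leviCivita (F.curve j) (F.interval j)) →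
      ∀ x ∈ F.Ω, Spacetime.tensorDivergence g.leviCivita F.energyMomentum x = 0 := by
    intro h x hx
    rw [F.tensorDivergence_energyMomentum _ hx (hdiv x hx), h1.1 h x hx, smul_zero]
  refine ⟨h1, h2, fun hρ ↦ ⟨fun h ↦ h1.2 fun x hx ↦ ?_, h2⟩⟩
  -- The set `s` is `{ρ > 0}` in `Ω`, where `ρ` can be cancelled from `ρ D_u u = 0`.
  refine g.leviCivita_self_eq_zero_of_mem_closure (a := -1) (F.contMDiffAt_u hx) ?_ (hρ hx) ?_
  · filter_upwards [F.isOpen_Ω.mem_nhds hx] with y hy using F.unit y hy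
  · rintro y ⟨hy, hy0⟩
    have := h y hy
    rw [F.tensorDivergence_energyMomentum _ hy (hdiv y hy)] at this
    exact (smul_eq_zero.1 this).resolve_left hy0.ne'
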